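/- Let $d \ge 2$. A random vector $X$ in $\mathbb{R}^d$ has an elliptical distribution with location $\mu \in \mathbb{R}^d$ and scatter $\Sigma \in \mathbb{R}^{d\times d}$ if $X$ is equal in distribution to $\mu + \mathcal{R}\Lambda U$, where $U$ is uniformly distributed on the unit sphere $\mathbb{S}^{d-1}$, the generating variate $\mathcal{R}$ is a nonnegative random variable independent of $U$, and $\Lambda \in \mathbb{R}^{d\times d}$ satisfies $\Lambda\Lambda^T = \Sigma$ with $\Sigma$ positive definite. The distribution has extreme value index $\gamma > 0$ if the distribution function $F$ of $\mathcal{R}$ satisfies, for some real sequences $a_n > 0$ and $b_n$ and for all $x \in \mathbb{R}$, $F^n(a_n x + b_n) \to G_\gamma(x)$ as $n \to \infty$, where $G_\gamma(x) = \exp\left(-(1+\gamma x)^{-1/\gamma}\right)$ if $1 + \gamma x > 0$ and $G_\gamma(x) = 0$ otherwise. For a sample $S_n = (X_1, \dots, X_n)$ in $\mathbb{R}^d$, a vector $m$, a matrix $A$ and $1 \le k < n$, let $D_{(1,n)} \ge \dots \ge D_{(n,n)}$ be the order statistics of the Mahalanobis distances $d_A(X_i, m) = \langle X_i - m,\, A^{-1}(X_i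 - m)\rangle^{1/2}$, and let $$\hat{H}_d(S_n, m, A, k, n) = \frac{1}{k}\sum_{i=1}^{k} \log\left(\frac{D_{(i,n)}}{D_{(k+1,n)}}\right)$$ be the separating Hill estimator. Theorem. Let $X_1, X_2, \dots$ be i.i.d. random vectors with a $d$-dimensional elliptical distribution with location $\mu$, scatter $\Sigma$ and extreme value index $\gamma > 0$. Let $\hat\mu_n$ and $\hat\Sigma_n$ be consistent estimators of $\mu$ and $\Sigma$, that is, $\hat\mu_n \to \mu$ and $\hat\Sigma_n \to \Sigma$ in probability. Let $k_n$ be positive integers with $k_n \to \infty$ and $k_n/n \to 0$ as $n \to \infty$. Then $$\hat{H}_d(S_n, \hat\mu_n, \hat\Sigma_n, k_n, n) \to \gamma \quad \text{in probability as } n \to \infty.$$ -/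

import Mathlib

open MeasureTheory ProbabilityTheory Filter Topology
-- matrices carry the operator norm induced by the Euclidean norm
open scoped Matrix.Norms.L2Operator

namespace SeparatingHill

noncomputable section

/-- The (generalized) extreme value distribution function `G_γ`. -/
def gev (γ x : ℝ) : ℝ :=
  if γ = 0 then Real.exp (-Real.exp (-x))
  else if 0 < 1 + γ * x then Real.exp (-(1 + γ * x) ^ (-1 / γ))
  else if 0 < γ then 0 else 1

/-- The probability measure `ρ` on `ℝ` has extreme value index `γ`: its distribution function `F`
is in the domain of attraction of `G_γ`, that is, `F (a n * x + b n) ^ n → G_γ x` for all real `x`,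
for some real sequences `a n > 0` and `b n`. -/
def HasExtremeValueIndex (ρ : Measure ℝ) (γ : ℝ) : Prop :=
  ∃ a b : ℕ → ℝ, (∀ n, 0 < a n) ∧
    ∀ x : ℝ, Tendsto (fun n : ℕ => (cdf ρ (a n * x + b n)) ^ n) atTop (𝓝 (gev γ x))

/-- The uniform distribution on the unit sphere of `ℝ^d`: the normalized surface measure. -/
def uniformSphere (d : ℕ) : Measure (Metric.sphere (0 : EuclideanSpace ℝ (Fin d)) 1) :=
  ((volume : Measure (EuclideanSpace ℝ (Fin d))).toSphere Set.univ)⁻¹ •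
    (volume : Measure (EuclideanSpace ℝ (Fin d))).toSphere

/-- The law of `m + 𝓡 Λ U`, where `𝓡` has law `ρ`, `U` is uniformly distributed on the unit sphere,
and `𝓡` and `U` are independent. -/
def ellipticalLaw {d : ℕ} (m : EuclideanSpace ℝ (Fin d)) (L : Matrix (Fin d) (Fin d) ℝ)
    (ρ : Measure ℝ) : Measure (EuclideanSpace ℝ (Fin d)) :=
  (ρ.prod (uniformSphere d)).map fun p =>
    m + p.1 • Matrix.toEuclideanCLM (𝕜 := ℝ) L (p.2 : EuclideanSpace ℝ (Fin d))

/-- `ν` is an elliptical distribution on `ℝ^d` with location `m`, (positive definite) scatter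
matrix `S` and a (nonnegative) generating variate with law `ρ`. -/
structure IsElliptical {d : ℕ} (ν : Measure (EuclideanSpace ℝ (Fin d)))
    (m : EuclideanSpace ℝ (Fin d)) (S : Matrix (Fin d) (Fin d) ℝ) (ρ : Measure ℝ) : Prop where
  isProbabilityMeasure : IsProbabilityMeasure ρ
  nonneg : ∀ᵐ r ∂ρ, 0 ≤ r
  posDef : S.PosDef
  exists_eq : ∃ L : Matrix (Fin d) (Fin d) ℝ, S = L * L.transpose ∧ ν = ellipticalLaw m L ρ

/-- The Mahalanobis distance of `x` and `y` relative to the matrix `A`. -/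
def mahalanobis {d : ℕ} (A : Matrix (Fin d) (Fin d) ℝ) (x y : EuclideanSpace ℝ (Fin d)) : ℝ :=
  √(inner ℝ (x - y) (Matrix.toEuclideanCLM (𝕜 := ℝ) A⁻¹ (x - y)))

/-- The order statistics `s_(1,n) ≥ s_(2,n) ≥ ⋯ ≥ s_(n,n)` of a sample `s` of `n` real numbers
(zero outside of the range `1 ≤ i ≤ n`): `Tuple.sort` sorts in increasing order, so it is applied
to the negatives. -/
def orderStat {n : ℕ} (s : Fin n → ℝ) (i : ℕ) : ℝ :=
  if h : 1 ≤ i ∧ i ≤ n then s (Tuple.sort (fun j => -s j) ⟨i - 1, by omega⟩) else 0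

/-- The Hill estimator of a real sample, based on its `k + 1` largest observations. -/
def hill {n : ℕ} (s : Fin n → ℝ) (k : ℕ) : ℝ :=
  (1 / (k : ℝ)) * ∑ i ∈ Finset.Icc 1 k, Real.log (orderStat s i / orderStat s (k + 1))

/-- The separating Hill estimator of the sample `x` under the location `m` and scatter `S`. -/
def separatingHill {d n : ℕ} (x : Fin n → EuclideanSpace ℝ (Fin d))
    (m : EuclideanSpace ℝ (Fin d)) (S : Matrix (Fin d) (Fin d) ℝ) (k : ℕ) : ℝ :=
  hill (fun i => mahalanobis S (x i) m) k

/-- Consistency of a sequence of estimators of the parameter `θ`: convergence in probability. -/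
def IsConsistent {Ω E : Type*} [MeasurableSpace Ω] [NormedAddCommGroup E] (P : Measure Ω)
    (est : ℕ → Ω → E) (θ : E) : Prop :=
  TendstoInMeasure P est atTop fun _ => θ

end

end SeparatingHill

open SeparatingHill

/-! If `X = m + R • L U`, then `L⁻¹ (X - m) = R • U`, so the true Mahalanobis distances `Y i` are
i.i.d. with the law of `R`. The estimated distances differ from the true ones by a factor close to 1
and a bounded shift. The Hill estimator uses only the largest distances, where the shift is
negligible too. So, for any `c > 1`, large distances are distorted by at most a factor `c` on an
event of probability tending to 1 (`exists_mahalanobis_close`).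

Each term of the Hill sum is a log⁺ of a ratio to a random order statistic. That order statistic
lies between `u / c ^ 2` and `c ^ 2 * u` for a deterministic threshold `u` exceeded by about `k`
observations. Monotonicity of log⁺ then traps the estimator between two normalized sums of i.i.d.
terms `log⁺ (Y i / v)`, with `v = c ^ 3 * u` and `v = u / c ^ 3` (`hill_bounds`). By Chebyshev these
converge to `γ * (c ^ 3) ^ (-1 / γ)` and `γ * ((c ^ 3)⁻¹) ^ (-1 / γ)`, and both limits approach `γ`
as `c → 1`.

The analytic input is `n * P(R > α n * y) → y ^ (-1 / γ)` (`exists_tendsto_tail`). Comparing the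
indices `n` and `n / 2` gives `α n / α (n / 2) → 2 ^ γ`, which makes the centering constants
negligible and yields a Potter bound (`tail_le_exp`). That bound dominates the layer cake integrals
for the moments (`posLog_moments`). -/

/-! ### Order statistics and deterministic bounds for the Hill estimator -/

section OrderStatistics

variable {n : ℕ} (s : Fin n → ℝ)

lemma antitone_comp_sort_neg : Antitone (s ∘ Tuple.sort fun j => -s j) := by
  intro i j hij
  have := Tuple.monotone_sort (fun j => -s j) hij
  simpa using this

lemma orderStat_succ {k : ℕ} (hk : k < n) :
    orderStat s (k + 1) = s (Tuple.sort (fun j => -s j) ⟨k, hk⟩) := by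
  simp [orderStat, Nat.succ_le_of_lt hk]

/-- Otherwise every index with `t < s i` would occupy one of the first `k` ranks. -/
lemma lt_orderStat_succ {k : ℕ} {t : ℝ} (h : k < (Finset.univ.filter fun i => t < s i).card) :
    t < orderStat s (k + 1) := by
  have hkn : k < n := h.trans_le ((Finset.card_le_univ _).trans_eq (Fintype.card_fin n))
  rw [orderStat_succ s hkn]
  by_contra! hle
  have hsub : (Finset.univ.filter fun i => t < s i) ⊆
      (Finset.Iio (⟨k, hkn⟩ : Fin n)).map (Tuple.sort fun j => -s j).toEmbedding := by
    intro i hi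
    simp only [Finset.mem_filter, Finset.mem_univ, true_and] at hi
    rw [Finset.mem_map_equiv, Finset.mem_Iio]
    by_contra! hge
    have := antitone_comp_sort_neg s hge
    simp only [Function.comp, Equiv.apply_symm_apply] at this
    linarith
  have := Finset.card_le_card hsub
  simp at this
  omega

lemma orderStat_succ_le {k : ℕ} {t : ℝ} (hkn : k < n)
    (h : (Finset.univ.filter fun i => t < s i).card ≤ k) : orderStat s (k + 1) ≤ t := by
  rw [orderStat_succ s hkn]
  by_contra! hlt
  have hsub : (Finset.Iic (⟨k, hkn⟩ : Fin n)).map (Tuple.sort fun j => -s j).toEmbedding ⊆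
      (Finset.univ.filter fun i => t < s i) := by
    intro i hi
    rw [Finset.mem_map_equiv, Finset.mem_Iic] at hi
    have := antitone_comp_sort_neg s hi
    simp only [Function.comp, Equiv.apply_symm_apply] at this
    simp only [Finset.mem_filter, Finset.mem_univ, true_and]
    linarith
  have := Finset.card_le_card hsub
  simp at this
  omega

/-- The Hill estimator is a sum of positive parts of logarithms over the whole sample. -/
lemma hill_eq_sum_posLog {k : ℕ} (hkn : k < n) (hs : ∀ i, 0 ≤ s i)
    (hpos : 0 < orderStat s (k + 1)) :
    hill s k = 1 / (k : ℝ) * ∑ i, Real.posLog (s i / orderStat s (k + 1)) := by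
  unfold hill
  congr 1
  set v := orderStat s (k + 1) with hv
  rw [← Equiv.sum_comp (Tuple.sort fun j => -s j) fun i => Real.posLog (s i / v)]
  -- In decreasing order the ratios to `v` are at least 1 on the first `k` ranks and at most 1
  -- afterwards, so log⁺ is log on the former and vanishes on the latter.
  have hpl : ∀ i : Fin n, Real.posLog (s (Tuple.sort (fun j => -s j) i) / v) =
      (fun i : ℕ => if i < k then Real.log (orderStat s (i + 1) / v) else 0) i := by
    intro i
    have hanti := antitone_comp_sort_neg s
    dsimp only
    rw [orderStat_succ s hkn] at hv
    split_ifs with hik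
    · rw [orderStat_succ s i.2]
      have h1 : v ≤ s (Tuple.sort (fun j => -s j) i) := by
        rw [hv]
        exact hanti (show i ≤ ⟨k, hkn⟩ from Fin.le_def.2 hik.le)
      rw [Real.posLog_eq_log]
      rw [abs_of_nonneg (div_nonneg (hs _) hpos.le)]
      exact (one_le_div hpos).2 h1
    · rw [Real.posLog_eq_zero_iff, abs_of_nonneg (div_nonneg (hs _) hpos.le)]
      refine (div_le_one hpos).2 ?_
      rw [hv]
      exact hanti (show ⟨k, hkn⟩ ≤ i from Fin.le_def.2 (not_lt.1 hik))
  rw [Finset.sum_congr rfl fun i _ => hpl i, Fin.sum_univ_eq_sum_range (fun i : ℕ =>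
    if i < k then Real.log (orderStat s (i + 1) / v) else 0) n, ← Finset.sum_filter]
  have : (Finset.range n).filter (fun i => i < k) = Finset.range k := by
    ext i
    simp only [Finset.mem_filter, Finset.mem_range]
    omega
  rw [this, Finset.range_eq_Ico, Finset.sum_Ico_add' (fun i => Real.log (orderStat s i / v)) 0 k 1]
  rfl

/-- Since log⁺ vanishes up to 1, two samples need only be compared at their large values, where the
distortion bounds are purely multiplicative. -/
lemma posLog_le_posLog_of_one_lt_imp {a b : ℝ} (ha : 0 ≤ a) (h : 1 < a → a ≤ b) :
    Real.posLog a ≤ Real.posLog b := by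
  rcases le_or_gt a 1 with h1 | h1
  · rw [(Real.posLog_eq_zero_iff a).2 (by rwa [abs_of_nonneg ha])]
    exact Real.posLog_nonneg
  · exact Real.posLog_le_posLog ha (h h1)

/-- Bounds for the Hill estimator of a sample `x` that is close to a sample `y`. -/
lemma hill_bounds {k : ℕ} {x y : Fin n → ℝ} {c u : ℝ} (hc : 1 < c) (hu : c ^ 3 < u)
    (hx : ∀ i, 0 ≤ x i) (hy : ∀ i, 0 ≤ y i) (hxy : ∀ i, x i ≤ c * max (y i) 1)
    (hyx : ∀ i, 1 ≤ y i → y i / c ≤ x i)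
    (hlow : k < (Finset.univ.filter fun i => u / c < y i).card)
    (hupp : (Finset.univ.filter fun i => c * u < y i).card ≤ k) :
    1 / (k : ℝ) * ∑ i, Real.posLog (y i / (c ^ 3 * u)) ≤ hill x k ∧
      hill x k ≤ 1 / (k : ℝ) * ∑ i, Real.posLog (y i / (u / c ^ 3)) := by
  have hc0 : 0 < c := by linarith
  have hc2 : 1 < c ^ 2 := one_lt_pow₀ hc (by norm_num)
  have hc3 : 1 < c ^ 3 := one_lt_pow₀ hc (by norm_num)
  have hu0 : 0 < u := by linarith
  have hkn : k < n := hlow.trans_le ((Finset.card_le_univ _).trans_eq (Fintype.card_fin n))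
  have hcu : c ^ 2 < u / c := by
    rw [lt_div_iff₀ hc0]
    linarith [pow_succ c 2]
  -- One factor `c` comes from the threshold in `hlow`, the other from passing from `y` to `x`;
  -- `hyx` applies because `u / c > c ^ 2 > 1`.
  have h1 : u / c ^ 2 < orderStat x (k + 1) := by
    refine lt_orderStat_succ x (hlow.trans_le (Finset.card_le_card fun i hi => ?_))
    simp only [Finset.mem_filter, Finset.mem_univ, true_and] at hi ⊢
    refine lt_of_lt_of_le ?_ (hyx i (by linarith))
    rw [pow_two, ← div_div]
    exact div_lt_div_of_pos_right hi hc0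
  have h2 : orderStat x (k + 1) ≤ c ^ 2 * u := by
    refine orderStat_succ_le x hkn (le_trans (Finset.card_le_card fun i hi => ?_) hupp)
    simp only [Finset.mem_filter, Finset.mem_univ, true_and] at hi ⊢
    have h3 : c * (c * u) < c * max (y i) 1 := by
      refine lt_of_lt_of_le ?_ (hxy i)
      linarith [pow_two c, mul_assoc c c u]
    have h4 := lt_of_mul_lt_mul_left h3 hc0.le
    rcases lt_max_iff.1 h4 with h5 | h5
    · exact h5
    · nlinarith
  set v := orderStat x (k + 1)
  have hv0 : 0 < v := lt_trans (by positivity) h1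
  rw [hill_eq_sum_posLog x hkn hx hv0]
  -- The third factor `c` comes from exchanging `y i` and `x i` in the numerator.
  constructor <;> refine mul_le_mul_of_nonneg_left (Finset.sum_le_sum fun i _ => ?_) (by positivity)
  · refine posLog_le_posLog_of_one_lt_imp (div_nonneg (hy i) (by positivity)) fun h => ?_
    rw [one_lt_div (by positivity)] at h
    have h3 := hyx i (by nlinarith)
    calc y i / (c ^ 3 * u) = y i / c / (c ^ 2 * u) := by field_simp
      _ ≤ x i / (c ^ 2 * u) := by gcongr
      _ ≤ x i / v := div_le_div_of_nonneg_left (hx i) hv0 h2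
  · refine posLog_le_posLog_of_one_lt_imp (div_nonneg (hx i) hv0.le) fun h => ?_
    rw [one_lt_div hv0] at h
    -- `x i > v > u / c ^ 2 > c` excludes the cutoff at 1, leaving `x i ≤ c * y i`.
    have h3 : c < c * max (y i) 1 := by
      refine lt_of_lt_of_le ?_ (hxy i)
      refine lt_of_le_of_lt ?_ (h1.trans h)
      rw [le_div_iff₀ (by positivity)]
      linarith [pow_succ c 2]
    have h4 : 1 < max (y i) 1 := lt_of_mul_lt_mul_left (by simpa using h3) hc0.le
    have h5 : 1 < y i := by simpa using h4
    have h6 := hxy i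
    rw [max_eq_left h5.le] at h6
    calc x i / v ≤ x i / (u / c ^ 2) := div_le_div_of_nonneg_left (hx i) (by positivity) h1.le
      _ ≤ c * y i / (u / c ^ 2) := by gcongr
      _ = y i / (u / c ^ 3) := by field_simp

end OrderStatistics

/-! ### Mahalanobis distances: stability in the parameters and law under an elliptical distribution
-/

section Mahalanobis

variable {d : ℕ}

lemma mahalanobis_nonneg (A : Matrix (Fin d) (Fin d) ℝ) (x y : EuclideanSpace ℝ (Fin d)) :
    0 ≤ mahalanobis A x y := Real.sqrt_nonneg _

lemma continuous_mahalanobis_left (A : Matrix (Fin d) (Fin d) ℝ) (y : EuclideanSpace ℝ (Fin d)) :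
    Continuous fun x => mahalanobis A x y := by
  unfold mahalanobis
  fun_prop

lemma isUnit_det_of_posDef_mul_transpose {S L : Matrix (Fin d) (Fin d) ℝ} (hS : S.PosDef)
    (hL : S = L * L.transpose) : IsUnit L.det := by
  have h := hS.det_pos
  rw [hL, Matrix.det_mul] at h
  exact isUnit_iff_ne_zero.2 (left_ne_zero_of_mul h.ne')

/-- `S⁻¹ = (L⁻¹)ᵀ L⁻¹`, and the transpose is the adjoint. -/
lemma inner_toEuclideanCLM_inv_self {S L : Matrix (Fin d) (Fin d) ℝ}
    (hL : S = L * L.transpose) (v : EuclideanSpace ℝ (Fin d)) :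
    inner ℝ v (Matrix.toEuclideanCLM (𝕜 := ℝ) S⁻¹ v) =
      ‖Matrix.toEuclideanCLM (𝕜 := ℝ) L⁻¹ v‖ ^ 2 := by
  have h : S⁻¹ = star (L⁻¹) * L⁻¹ := by
    rw [hL, Matrix.mul_inv_rev, Matrix.star_eq_conjTranspose, 
      Matrix.conjTranspose_eq_transpose_of_trivial, Matrix.transpose_nonsing_inv]
  rw [h, map_mul, map_star, ContinuousLinearMap.star_eq_adjoint, mul_apply_eq_comp,
    ContinuousLinearMap.adjoint_inner_right, real_inner_self_eq_norm_sq]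

lemma mahalanobis_eq_norm {S L : Matrix (Fin d) (Fin d) ℝ}
    (hL : S = L * L.transpose) (x y : EuclideanSpace ℝ (Fin d)) :
    mahalanobis S x y = ‖Matrix.toEuclideanCLM (𝕜 := ℝ) L⁻¹ (x - y)‖ := by
  rw [mahalanobis, inner_toEuclideanCLM_inv_self hL, Real.sqrt_sq (norm_nonneg _)]

lemma continuousAt_inv_of_isUnit_det {S : Matrix (Fin d) (Fin d) ℝ} (hS : IsUnit S.det) :
    ContinuousAt (fun A : Matrix (Fin d) (Fin d) ℝ => A⁻¹) S := by
  simp_rw [Matrix.inv_def, Ring.inverse_eq_inv']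
  have h1 : ContinuousAt (fun A : Matrix (Fin d) (Fin d) ℝ => A.det) S :=
    (continuous_id.matrix_det).continuousAt
  have h2 : ContinuousAt (fun A : Matrix (Fin d) (Fin d) ℝ => A.adjugate) S :=
    (continuous_id.matrix_adjugate).continuousAt
  exact (h1.inv₀ hS.ne_zero).smul h2

/-- Mahalanobis distances relative to nearby parameters are close, uniformly in the point. -/
lemma exists_mahalanobis_close {S L : Matrix (Fin d) (Fin d) ℝ} (hS : S.PosDef)
    (hL : S = L * L.transpose) (m : EuclideanSpace ℝ (Fin d)) {c : ℝ} (hc : 1 < c) :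
    ∃ δ > 0, ∀ A : Matrix (Fin d) (Fin d) ℝ, ∀ m' : EuclideanSpace ℝ (Fin d),
      ‖A - S‖ < δ → ‖m' - m‖ < δ → ∀ x,
        mahalanobis A x m' ≤ c * max (mahalanobis S x m) 1 ∧
        (1 ≤ mahalanobis S x m → mahalanobis S x m / c ≤ mahalanobis A x m') := by
  have hLu := isUnit_det_of_posDef_mul_transpose hS hL
  have hc0 : 0 < c := by linarith
  -- The distortion `c = b * b` is split: one factor `b` for the error in the scatter, one for the
  -- error in the location.
  set b := √c with hb
  have hb1 : 1 < b := by rw [hb]; exact Real.lt_sqrt_of_sq_lt (by simpa)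
  have hb0 : 0 < b := by linarith
  have hbc : b * b = c := Real.mul_self_sqrt hc0.le
  have hbi : b⁻¹ < 1 := inv_lt_one_of_one_lt₀ hb1
  have hbi0 : 0 < b⁻¹ := inv_pos.2 hb0
  set K := Matrix.toEuclideanCLM (𝕜 := ℝ) L⁻¹
  have hKL : ∀ v, ‖v‖ ≤ ‖L‖ * ‖K v‖ := by
    intro v
    have h1 : Matrix.toEuclideanCLM (𝕜 := ℝ) L (K v) = v := by
      rw [← mul_apply_eq_comp, ← map_mul, Matrix.mul_nonsing_inv _ hLu, map_one]
      rfl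
    calc ‖v‖ = ‖Matrix.toEuclideanCLM (𝕜 := ℝ) L (K v)‖ := by rw [h1]
      _ ≤ _ := ContinuousLinearMap.le_opNorm _ _
  -- the admissible relative errors
  obtain ⟨σ, hσ0, hσ1, hσ2⟩ : ∃ σ > 0, 1 + σ ≤ b ∧ b⁻¹ ≤ 1 - σ := by
    refine ⟨min (b - 1) (1 - b⁻¹), lt_min (by linarith) (by linarith), ?_, ?_⟩
    · linarith [min_le_left (b - 1) (1 - b⁻¹)]
    · linarith [min_le_right (b - 1) (1 - b⁻¹)]
  -- Since `‖w‖ ≤ ‖L‖ * q`, an error of this size in `A⁻¹` changes the quadratic form by at most `σ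
  -- * q ^ 2`; the `+ 1` avoids dividing by zero.
  have hη : 0 < σ / (‖L‖ ^ 2 + 1) := by positivity
  obtain ⟨δ₁, hδ₁, hinv⟩ := Metric.continuousAt_iff.1
    (continuousAt_inv_of_isUnit_det (isUnit_iff_ne_zero.2 hS.det_pos.ne')) _ hη
  refine ⟨min δ₁ (σ / (‖K‖ + 1)), lt_min hδ₁ (by positivity), fun A m' hA hm x => ?_⟩
  have hinvA := hinv (x := A) (by rw [dist_eq_norm]; exact hA.trans_le (min_le_left _ _))
  rw [dist_eq_norm] at hinvA
  rw [mahalanobis_eq_norm hL]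
  set Y := ‖K (x - m)‖
  set w := x - m' with hw
  set q := ‖K w‖ with hq
  have hq0 : 0 ≤ q := norm_nonneg _
  have hKm : ‖K (m' - m)‖ ≤ σ := by
    have h1 : ‖m' - m‖ ≤ σ / (‖K‖ + 1) := (hm.trans_le (min_le_right _ _)).le
    calc ‖K (m' - m)‖ ≤ ‖K‖ * ‖m' - m‖ := K.le_opNorm _
      _ ≤ (‖K‖ + 1) * (σ / (‖K‖ + 1)) := by gcongr; linarith
      _ = σ := by field_simp
  have hdiff : x - m = w + (m' - m) := by rw [hw]; abel
  have hY1 : Y ≤ q + σ := by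
    calc Y = ‖K w + K (m' - m)‖ := by rw [← map_add, ← hdiff]
      _ ≤ q + ‖K (m' - m)‖ := norm_add_le _ _
      _ ≤ _ := by gcongr
  have hY2 : q ≤ Y + σ := by
    calc q = ‖K (x - m) - K (m' - m)‖ := by rw [← map_sub, hdiff, add_sub_cancel_right]
      _ ≤ Y + ‖K (m' - m)‖ := norm_sub_le _ _
      _ ≤ _ := by gcongr
  have hform : |inner ℝ w (Matrix.toEuclideanCLM (𝕜 := ℝ) A⁻¹ w) - q ^ 2| ≤ σ * q ^ 2 := by
    rw [hq, ← inner_toEuclideanCLM_inv_self hL, ← inner_sub_right, ← sub_apply,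
      ← map_sub]
    calc |inner ℝ w (Matrix.toEuclideanCLM (𝕜 := ℝ) (A⁻¹ - S⁻¹) w)|
        ≤ ‖w‖ * ‖Matrix.toEuclideanCLM (𝕜 := ℝ) (A⁻¹ - S⁻¹) w‖ := abs_real_inner_le_norm _ _
      _ ≤ ‖w‖ * (‖A⁻¹ - S⁻¹‖ * ‖w‖) := by
        gcongr
        exact ContinuousLinearMap.le_opNorm _ _
      _ ≤ (‖L‖ * q) * (σ / (‖L‖ ^ 2 + 1) * (‖L‖ * q)) := by
        gcongr
        · exact hKL w
        · exact hKL w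
      _ = σ * q ^ 2 * (‖L‖ ^ 2 / (‖L‖ ^ 2 + 1)) := by ring
      _ ≤ σ * q ^ 2 * 1 := by
        gcongr
        rw [div_le_one (by positivity)]
        linarith
      _ = σ * ‖K w‖ ^ 2 := by rw [mul_one]
    rw [← inner_toEuclideanCLM_inv_self hL]
  obtain ⟨hf1, hf2⟩ := abs_le.1 hform
  -- Square roots are taken using `1 + σ ≤ b ≤ b ^ 2`, and below using `b⁻¹ ^ 2 ≤ b⁻¹ ≤ 1 - σ`.
  have hup : mahalanobis A x m' ≤ b * q := by
    refine Real.sqrt_le_iff.2 ⟨by positivity, ?_⟩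
    nlinarith [sq_nonneg q, mul_nonneg (sq_nonneg q) (sub_nonneg.2 hb1.le)]
  have hlo : b⁻¹ * q ≤ mahalanobis A x m' := by
    refine Real.le_sqrt_of_sq_le ?_
    have : (b⁻¹ * q) ^ 2 ≤ b⁻¹ * q ^ 2 := by
      rw [mul_pow]
      gcongr
      nlinarith
    nlinarith [sq_nonneg q]
  constructor
  · calc mahalanobis A x m' ≤ b * q := hup
      _ ≤ b * (Y + σ) := by gcongr
      -- The additive location error becomes relative: `Y + σ ≤ (1 + σ) * max Y 1`.
      _ ≤ b * (b * max Y 1) := by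
        gcongr
        nlinarith [le_max_left Y 1, le_max_right Y 1]
      _ = c * max Y 1 := by rw [← mul_assoc, hbc]
  · intro hY
    calc Y / c = b⁻¹ * (b⁻¹ * Y) := by rw [← hbc]; field_simp
      _ ≤ b⁻¹ * q := by
        gcongr
        nlinarith
      _ ≤ _ := hlo

lemma isProbabilityMeasure_uniformSphere (hd : d ≠ 0) :
    IsProbabilityMeasure (uniformSphere d) := by
  have : Nontrivial (EuclideanSpace ℝ (Fin d)) := by
    have : Nonempty (Fin d) := Fin.pos_iff_nonempty.1 (Nat.pos_of_ne_zero hd)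
    infer_instance
  refine ⟨?_⟩
  rw [uniformSphere, Measure.smul_apply, smul_eq_mul]
  refine ENNReal.inv_mul_cancel ?_ (measure_ne_top _ _)
  rw [Ne, Measure.measure_univ_eq_zero]
  exact Measure.toSphere_ne_zero _

/-- The Mahalanobis distance to the location has the law of the generating variate. -/
lemma map_mahalanobis_of_isElliptical (hd : d ≠ 0) {ν : Measure (EuclideanSpace ℝ (Fin d))}
    {m : EuclideanSpace ℝ (Fin d)} {S : Matrix (Fin d) (Fin d) ℝ} {ρ : Measure ℝ}
    (h : IsElliptical ν m S ρ) : ν.map (fun x => mahalanobis S x m) = ρ := by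
  obtain ⟨L, hL, rfl⟩ := h.exists_eq
  have := h.isProbabilityMeasure
  have := isProbabilityMeasure_uniformSphere hd
  have hLu := isUnit_det_of_posDef_mul_transpose h.posDef hL
  have hmeas : Measurable fun p : ℝ × Metric.sphere (0 : EuclideanSpace ℝ (Fin d)) 1 =>
      m + p.1 • Matrix.toEuclideanCLM (𝕜 := ℝ) L (p.2 : EuclideanSpace ℝ (Fin d)) := by
    fun_prop
  rw [ellipticalLaw, Measure.map_map (continuous_mahalanobis_left S m).measurable hmeas]
  -- The factor `L⁻¹` undoes `L`, and the point of the sphere has norm 1, so only `|r|` remains.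
  have heq : (fun x => mahalanobis S x m) ∘
      (fun p : ℝ × Metric.sphere (0 : EuclideanSpace ℝ (Fin d)) 1 =>
        m + p.1 • Matrix.toEuclideanCLM (𝕜 := ℝ) L (p.2 : EuclideanSpace ℝ (Fin d))) =
      (fun r => |r|) ∘ Prod.fst := by
    ext p
    simp only [Function.comp, mahalanobis_eq_norm hL, add_sub_cancel_left, map_smul]
    rw [← mul_apply_eq_comp, ← map_mul, Matrix.nonsing_inv_mul _ hLu, map_one]
    simp [norm_smul]
  rw [heq, ← Measure.map_map measurable_abs measurable_fst, Measure.map_fst_prod,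
    measure_univ, one_smul]
  have : (fun r : ℝ => |r|) =ᵐ[ρ] id := by
    filter_upwards [h.nonneg] with r hr using abs_of_nonneg hr
  rw [Measure.map_congr this, Measure.map_id]

end Mahalanobis

/-! ### Norming constants without centering, and a Potter bound -/

section RegularVariation

/-- A nonnegative sequence with `r n ≤ c * r (n / 2) + e n`, `c < 1` and `e n → 0` tends to `0`. -/
lemma tendsto_zero_of_le_half {r e : ℕ → ℝ} {c : ℝ} (hr : ∀ n, 0 ≤ r n) (hc0 : 0 ≤ c) (hc1 : c < 1)
    (he : Tendsto e atTop (𝓝 0)) (h : ∀ᶠ n in atTop, r n ≤ c * r (n / 2) + e n) :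
    Tendsto r atTop (𝓝 0) := by
  refine tendsto_order.2 ⟨fun a ha => Eventually.of_forall fun n => ha.trans_le (hr n),
    fun ε hε => ?_⟩
  have he' : ∀ᶠ n in atTop, e n < ε / 2 * (1 - c) :=
    he.eventually (gt_mem_nhds (mul_pos (by linarith) (by linarith)))
  obtain ⟨n₁, hn₁⟩ := eventually_atTop.1 ((h.and he').and (eventually_ge_atTop 1))
  -- Subtracting `ε / 2`, the fixed point of `x ↦ c * x + ε / 2 * (1 - c)`, turns the recursion into
  -- a pure contraction.
  have hstep : ∀ n ≥ n₁ + 1, r n - ε / 2 ≤ c * (r (n / 2) - ε / 2) := by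
    intro n hn
    have := hn₁ n (by omega)
    linarith [this.1.1, this.1.2]
  obtain ⟨M, hM0, hM⟩ : ∃ M, 0 ≤ M ∧ ∀ n < n₁ + 1, r n - ε / 2 ≤ M := by
    refine ⟨∑ n ∈ Finset.range (n₁ + 1), r n, Finset.sum_nonneg fun n _ => hr n, fun n hn => ?_⟩
    have := Finset.single_le_sum (fun n _ => hr n) (Finset.mem_range.2 hn)
    linarith
  have hbdd : ∀ n, r n - ε / 2 ≤ M := by
    intro n
    induction n using Nat.strong_induction_on with
    | _ n ih =>
      rcases lt_or_ge n (n₁ + 1) with hn | hn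
      · exact hM n hn
      · have h1 := ih (n / 2) (by omega)
        have h2 := hstep n hn
        nlinarith
  have hpow : ∀ j n, 2 ^ j * (n₁ + 1) ≤ n → r n - ε / 2 ≤ c ^ j * M := by
    intro j
    induction j with
    | zero => intro n _; simpa using hbdd n
    | succ j ih =>
      intro n hn
      have h0 : 1 ≤ 2 ^ j := Nat.one_le_two_pow
      have h1 : 2 ^ j * (n₁ + 1) ≤ n / 2 := by
        rw [Nat.le_div_iff_mul_le (by norm_num)]
        rw [pow_succ] at hn
        linarith
      have h2 := hstep n <| by
        calc n₁ + 1 ≤ 2 ^ j * (n₁ + 1) := Nat.le_mul_of_pos_left _ (by positivity)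
          _ ≤ n := h1.trans (Nat.div_le_self _ _)
      calc r n - ε / 2 ≤ c * (r (n / 2) - ε / 2) := h2
        _ ≤ c * (c ^ j * M) := by gcongr; exact ih _ h1
        _ = _ := by ring
  have hlim : Tendsto (fun j : ℕ => c ^ j * M) atTop (𝓝 0) := by
    simpa using (tendsto_pow_atTop_nhds_zero_of_lt_one hc0 hc1).mul_const M
  obtain ⟨j, hj⟩ := (hlim.eventually (gt_mem_nhds (half_pos hε))).exists
  filter_upwards [eventually_ge_atTop (2 ^ j * (n₁ + 1))] with n hn
  linarith [hpow j n hn]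

/-- If `F n ^ n → exp (-t)`, then `n * (1 - F n) → t`. -/
lemma tendsto_mul_one_sub_of_tendsto_pow {F : ℕ → ℝ} (hF : ∀ n, 0 ≤ F n) {t : ℝ}
    (h : Tendsto (fun n => F n ^ n) atTop (𝓝 (Real.exp (-t)))) :
    Tendsto (fun n : ℕ => (n : ℝ) * (1 - F n)) atTop (𝓝 t) := by
  have hlog : Tendsto (fun n : ℕ => (n : ℝ) * Real.log (F n)) atTop (𝓝 (-t)) := by
    have := (Real.continuousAt_log (Real.exp_pos (-t)).ne').tendsto.comp h
    simpa [Function.comp_def] using this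
  have hl0 : Tendsto (fun n : ℕ => Real.log (F n)) atTop (𝓝 0) := by
    have := hlog.mul (tendsto_inv_atTop_nhds_zero_nat (𝕜 := ℝ))
    rw [mul_zero] at this
    refine this.congr' ?_
    filter_upwards [eventually_gt_atTop 0] with n hn
    have : (n : ℝ) ≠ 0 := by positivity
    field_simp
  have hsq : Tendsto (fun n : ℕ => |(n : ℝ) * Real.log (F n) * Real.log (F n)|) atTop (𝓝 0) := by
    simpa using (hlog.mul hl0).abs
  -- With `x = log (F n) → 0`, the bound `|exp x - 1 - x| ≤ x ^ 2` leaves the error `n * x ^ 2 = (n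
  -- * x) * x → 0`.
  have hdiff : Tendsto (fun n : ℕ => (n : ℝ) * (1 - F n) + (n : ℝ) * Real.log (F n))
      atTop (𝓝 0) := by
    refine squeeze_zero_norm' ?_ hsq
    have hl1 : ∀ᶠ n in atTop, |Real.log (F n)| < 1 := by
      have := hl0.abs
      rw [abs_zero] at this
      exact this.eventually (gt_mem_nhds one_pos)
    filter_upwards [hl1, h.eventually (lt_mem_nhds (Real.exp_pos (-t))), eventually_gt_atTop 0]
      with n h1 h2 h3
    -- Needed for `exp (log (F n)) = F n`, since `Real.log 0 = 0`.
    have hFpos : 0 < F n := by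
      refine (hF n).lt_of_ne fun h0 => ?_
      rw [← h0, zero_pow h3.ne'] at h2
      exact lt_irrefl _ h2
    have h4 := Real.abs_exp_sub_one_sub_id_le h1.le
    rw [Real.exp_log hFpos] at h4
    rw [Real.norm_eq_abs]
    calc |(n : ℝ) * (1 - F n) + n * Real.log (F n)|
        = n * |F n - 1 - Real.log (F n)| := by
          rw [← abs_neg, ← abs_of_nonneg (Nat.cast_nonneg (α := ℝ) n), ← abs_mul,
            abs_of_nonneg (Nat.cast_nonneg (α := ℝ) n)]
          congr 1
          ring
      _ ≤ n * Real.log (F n) ^ 2 := by gcongr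
      _ ≤ _ := by
          rw [mul_assoc, ← pow_two]
          exact le_abs_self _
  have := hdiff.sub hlog
  simpa using this

variable {ρ : Measure ℝ} {γ : ℝ}

/-- The extreme value condition as convergence of rescaled tail functions. -/
lemma exists_tendsto_tail_affine [IsProbabilityMeasure ρ] (hγ : 0 < γ)
    (h : HasExtremeValueIndex ρ γ) :
    ∃ α β : ℕ → ℝ, (∀ n, 0 < α n) ∧ ∀ y : ℝ, 0 < y →
      Tendsto (fun n : ℕ => (n : ℝ) * ρ.real (Set.Ioi (α n * y + β n))) atTop
        (𝓝 (y ^ (-1 / γ))) := by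
  obtain ⟨a, b, ha, hlim⟩ := h
  refine ⟨fun n => a n / γ, fun n => b n - a n / γ, fun n => div_pos (ha n) hγ, fun y hy => ?_⟩
  have h1 := hlim ((y - 1) / γ)
  -- The substitution `y = 1 + γ * x` turns `G_γ` into `exp (-y ^ (-1 / γ))`.
  have h2 : 1 + γ * ((y - 1) / γ) = y := by field_simp; ring
  rw [gev, if_neg hγ.ne', h2, if_pos hy] at h1
  refine (tendsto_mul_one_sub_of_tendsto_pow (fun n => cdf_nonneg _ _) h1).congr fun n => ?_
  have h3 : a n * ((y - 1) / γ) + b n = a n / γ * y + (b n - a n / γ) := by field_simp; ring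
  rw [h3, cdf_eq_real, ← probReal_compl_eq_one_sub measurableSet_Iic, Set.compl_Iic]

/-- The types lemma for the limit `y ^ (-1 / γ)`. -/
lemma tendsto_affine_of_tendsto_tail [IsProbabilityMeasure ρ] (hγ : 0 < γ) {α β : ℕ → ℝ}
    (hα : ∀ n, 0 < α n)
    (hlim : ∀ y : ℝ, 0 < y → Tendsto (fun n : ℕ => (n : ℝ) * ρ.real (Set.Ioi (α n * y + β n))) atTop
        (𝓝 (y ^ (-1 / γ))))
    {p q : ℕ → ℕ} (hp : Tendsto p atTop atTop) (hq : Tendsto q atTop atTop) {l : ℝ} (hl : 0 < l)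
    (hpq : Tendsto (fun n => (q n : ℝ) / p n) atTop (𝓝 l)) {y : ℝ} (hy : 0 < y) :
    Tendsto (fun n => (α (q n) * y + β (q n) - β (p n)) / α (p n)) atTop (𝓝 (l ^ γ * y)) := by
  set z : ℕ → ℝ := fun n => (α (q n) * y + β (q n) - β (p n)) / α (p n) with hz
  have hzα : ∀ n, α (p n) * z n + β (p n) = α (q n) * y + β (q n) := by
    intro n
    have := (hα (p n)).ne'
    simp only [hz]
    field_simp
    ring
  have hl0 : 0 < l ^ γ * y := by positivity
  have hexp : -1 / γ < 0 := div_neg_of_neg_of_pos (by norm_num) hγ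
  have hlimz : Tendsto (fun n => (p n : ℝ) * ρ.real (Set.Ioi (α (p n) * z n + β (p n)))) atTop
      (𝓝 ((l ^ γ * y) ^ (-1 / γ))) := by
    have h1 := ((hlim y hy).comp hq).div hpq hl.ne'
    have h2 : (l ^ γ * y) ^ (-1 / γ) = y ^ (-1 / γ) / l := by
      rw [Real.mul_rpow (by positivity) hy.le, ← Real.rpow_mul hl.le, mul_div_cancel₀ _ hγ.ne',
        Real.rpow_neg_one]
      field_simp
    rw [h2]
    refine h1.congr' ?_
    filter_upwards [hp.eventually (eventually_gt_atTop 0), hq.eventually (eventually_gt_atTop 0)]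
      with n h3 h4
    have h5 : (p n : ℝ) ≠ 0 := by positivity
    have h6 : (q n : ℝ) ≠ 0 := by positivity
    simp only [Function.comp, Pi.div_apply, hzα]
    field_simp
  have hmono : ∀ n (s t : ℝ), s ≤ t → (p n : ℝ) * ρ.real (Set.Ioi (α (p n) * t + β (p n))) ≤
      (p n : ℝ) * ρ.real (Set.Ioi (α (p n) * s + β (p n))) := by
    intro n s t hst
    refine mul_le_mul_of_nonneg_left (measureReal_mono (Set.Ioi_subset_Ioi ?_)) (by positivity)
    have := mul_le_mul_of_nonneg_left hst (hα (p n)).le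
    linarith
  -- The tails are nonincreasing and their limit is strictly decreasing, so the limit of the tails
  -- at `z n` locates `z n`. In the lower bound, `max s 0` keeps the comparison point positive,
  -- where the limit is known.
  refine tendsto_order.2 ⟨fun s hs => ?_, fun t ht => ?_⟩
  · obtain ⟨s', hs', hs'l⟩ := exists_between (max_lt hs hl0)
    have hs0 : 0 < s' := (le_max_right _ _).trans_lt hs'
    have h1 := Real.rpow_lt_rpow_of_neg hs0 hs'l hexp
    filter_upwards [hlimz.eventually_lt ((hlim s' hs0).comp hp) h1] with n hn
    by_contra! hle
    exact absurd (hmono n _ _ (hle.trans ((le_max_left _ _).trans hs'.le))) (not_le.2 hn)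
  · have h1 := Real.rpow_lt_rpow_of_neg hl0 ht hexp
    filter_upwards [((hlim t (hl0.trans ht)).comp hp).eventually_lt hlimz h1] with n hn
    by_contra! hle
    exact absurd (hmono n _ _ hle) (not_le.2 hn)

lemma tendsto_half_atTop : Tendsto (fun n : ℕ => n / 2) atTop atTop :=
  Nat.tendsto_div_const_atTop (by norm_num)

lemma tendsto_div_half : Tendsto (fun n : ℕ => (n : ℝ) / ((n / 2 : ℕ) : ℝ)) atTop (𝓝 2) := by
  have h1 : Tendsto (fun n : ℕ => (((n / 2 : ℕ) : ℝ))⁻¹) atTop (𝓝 0) :=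
    (tendsto_inv_atTop_nhds_zero_nat (𝕜 := ℝ)).comp tendsto_half_atTop
  have h2 : Tendsto (fun n : ℕ => 2 + (((n / 2 : ℕ) : ℝ))⁻¹) atTop (𝓝 2) := by
    simpa using h1.const_add 2
  refine tendsto_of_tendsto_of_tendsto_of_le_of_le' tendsto_const_nhds h2 ?_ ?_
  · filter_upwards [eventually_ge_atTop 2] with n hn
    have h3 : 0 < n / 2 := by omega
    have h4 : 2 * (n / 2) ≤ n := by omega
    rw [le_div_iff₀ (by exact_mod_cast h3)]
    exact_mod_cast h4
  · filter_upwards [eventually_ge_atTop 2] with n hn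
    have h3 : 0 < n / 2 := by omega
    have h4 : n ≤ 2 * (n / 2) + 1 := by omega
    have h5 : (0 : ℝ) < ((n / 2 : ℕ) : ℝ) := by exact_mod_cast h3
    rw [div_le_iff₀ h5, add_mul, inv_mul_cancel₀ h5.ne']
    exact_mod_cast h4

/-- The extreme value condition with positive index, with centering constants `0`. -/
lemma exists_tendsto_tail [IsProbabilityMeasure ρ] (hγ : 0 < γ) (h : HasExtremeValueIndex ρ γ) :
    ∃ α : ℕ → ℝ, (∀ n, 0 < α n) ∧ Tendsto α atTop atTop ∧
      Tendsto (fun n => α n / α (n / 2)) atTop (𝓝 (2 ^ γ)) ∧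
      ∀ y : ℝ, 0 < y →
        Tendsto (fun n : ℕ => (n : ℝ) * ρ.real (Set.Ioi (α n * y))) atTop (𝓝 (y ^ (-1 / γ))) := by
  obtain ⟨α, β, hα, hlim⟩ := exists_tendsto_tail_affine hγ h
  -- These affine maps of `y` converge to `y ↦ 2 ^ γ * y`; the values at 1 and 2 give the limits of
  -- slope and intercept.
  have haff : ∀ y : ℝ, 0 < y →
      Tendsto (fun n => (α n * y + β n - β (n / 2)) / α (n / 2)) atTop (𝓝 (2 ^ γ * y)) :=
    fun y hy => tendsto_affine_of_tendsto_tail hγ hα hlim tendsto_half_atTop tendsto_id two_pos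
      tendsto_div_half hy
  have hratio : Tendsto (fun n => α n / α (n / 2)) atTop (𝓝 (2 ^ γ)) := by
    have h1 := (haff 2 two_pos).sub (haff 1 one_pos)
    rw [show (2 : ℝ) ^ γ * 2 - 2 ^ γ * 1 = 2 ^ γ by ring] at h1
    refine h1.congr fun n => ?_
    rw [← sub_div]
    congr 1
    ring
  have hβdiff : Tendsto (fun n => (β n - β (n / 2)) / α (n / 2)) atTop (𝓝 0) := by
    have h1 := (haff 1 one_pos).sub hratio
    rw [mul_one, sub_self] at h1
    refine h1.congr fun n => ?_
    rw [← sub_div]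
    congr 1
    ring
  -- As `2 ^ γ > 1`, halving the index contracts by a factor `b⁻¹ < 1`; this drives both `(α n)⁻¹`
  -- and `β n / α n` to zero.
  obtain ⟨b, hb1, hb2⟩ := exists_between (Real.one_lt_rpow (one_lt_two : (1 : ℝ) < 2) hγ)
  have hb0 : 0 < b := by linarith
  have hcontr : ∀ᶠ n in atTop, α (n / 2) / α n ≤ b⁻¹ := by
    filter_upwards [hratio.eventually (lt_mem_nhds hb2)] with n hn
    rw [← inv_div]
    exact inv_anti₀ hb0 hn.le
  have hinv : Tendsto (fun n => (α n)⁻¹) atTop (𝓝 0) := by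
    refine tendsto_zero_of_le_half (fun n => (inv_pos.2 (hα n)).le) (inv_pos.2 hb0).le
      (inv_lt_one_of_one_lt₀ hb1) tendsto_const_nhds ?_
    filter_upwards [hcontr] with n hn
    have := (hα (n / 2))
    have := (hα n)
    calc (α n)⁻¹ = α (n / 2) / α n * (α (n / 2))⁻¹ := by field_simp
      _ ≤ b⁻¹ * (α (n / 2))⁻¹ := by gcongr
      _ = _ := by ring
  have hβα : Tendsto (fun n => β n / α n) atTop (𝓝 0) := by
    rw [tendsto_zero_iff_abs_tendsto_zero]
    refine tendsto_zero_of_le_half (e := fun n => |(β n - β (n / 2)) / α (n / 2)|)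
      (fun n => abs_nonneg _) (inv_pos.2 hb0).le (inv_lt_one_of_one_lt₀ hb1)
      (by simpa using hβdiff.abs) ?_
    filter_upwards [hcontr] with n hn
    have h1 := (hα (n / 2))
    have h2 := (hα n)
    have h3 : b⁻¹ ≤ 1 := (inv_lt_one_of_one_lt₀ hb1).le
    have h4 : β n / α n =
        α (n / 2) / α n * (β (n / 2) / α (n / 2) + (β n - β (n / 2)) / α (n / 2)) := by
      field_simp
      ring
    simp only [Function.comp]
    rw [h4, abs_mul, abs_of_pos (div_pos h1 h2)]
    calc _ ≤ b⁻¹ * (|β (n / 2) / α (n / 2)| + |(β n - β (n / 2)) / α (n / 2)|) := by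
          gcongr
          exact abs_add_le _ _
      _ ≤ _ := by
          rw [mul_add]
          gcongr
          exact mul_le_of_le_one_left (abs_nonneg _) h3
  refine ⟨α, hα, ?_, hratio, fun y hy => ?_⟩
  · have h1 : Tendsto (fun n => (α n)⁻¹) atTop (𝓝[>] 0) :=
      tendsto_nhdsWithin_iff.2 ⟨hinv, Eventually.of_forall fun n => inv_pos.2 (hα n)⟩
    refine h1.inv_tendsto_nhdsGT_zero.congr fun n => ?_
    simp
  have hexp : -1 / γ < 0 := div_neg_of_neg_of_pos (by norm_num) hγ
  have hcont : ContinuousAt (fun t : ℝ => t ^ (-1 / γ)) y :=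
    Real.continuousAt_rpow_const _ _ (Or.inl hy.ne')
  have hsmall : ∀ δ > 0, ∀ᶠ n in atTop, |β n| < δ * α n := by
    intro δ hδ
    have h1 := hβα.abs
    rw [abs_zero] at h1
    filter_upwards [h1.eventually (gt_mem_nhds hδ)] with n hn
    rwa [abs_div, abs_of_pos (hα n), div_lt_iff₀ (hα n)] at hn
  have hev : ∀ {s t : ℝ}, s < t → ∀ᶠ n in atTop, α n * s + β n ≤ α n * t := by
    intro s t hst
    filter_upwards [hsmall (t - s) (by linarith)] with n hn
    nlinarith [le_abs_self (β n)]
  have hev' : ∀ {s t : ℝ}, s < t → ∀ᶠ n in atTop, α n * s ≤ α n * t + β n := by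
    intro s t hst
    filter_upwards [hsmall (t - s) (by linarith)] with n hn
    nlinarith [neg_abs_le (β n)]
  -- As `β n` is negligible against `α n`, the point `α n * y` is compared with `α n * t + β n` for
  -- `t` slightly above or below `y`, and the limit is continuous in `t`.
  refine tendsto_order.2 ⟨fun l hl => ?_, fun l hl => ?_⟩
  · obtain ⟨t, hyt, ht⟩ : ∃ t > y, l < t ^ (-1 / γ) :=
      (((hcont.eventually (lt_mem_nhds hl)).filter_mono
        (nhdsWithin_le_nhds (s := Set.Ioi y))).and
        self_mem_nhdsWithin).exists.imp fun t ht => ⟨ht.2, ht.1⟩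
    filter_upwards [(hlim t (hy.trans hyt)).eventually (lt_mem_nhds ht), hev' hyt] with n h1 h2
    exact h1.trans_le <| mul_le_mul_of_nonneg_left
      (measureReal_mono (Set.Ioi_subset_Ioi h2)) (Nat.cast_nonneg n)
  · obtain ⟨t, ⟨ht0, hty⟩, ht⟩ : ∃ t, (0 < t ∧ t < y) ∧ t ^ (-1 / γ) < l :=
      ((((hcont.eventually (gt_mem_nhds hl)).filter_mono
        (nhdsWithin_le_nhds (s := Set.Iio y))).and
        ((lt_mem_nhds hy).filter_mono nhdsWithin_le_nhds)).and
        self_mem_nhdsWithin).exists.imp fun t ht => ⟨⟨ht.1.2, ht.2⟩, ht.1.1⟩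
    filter_upwards [(hlim t ht0).eventually (gt_mem_nhds ht), hev hty] with n h1 h2
    exact lt_of_le_of_lt (mul_le_mul_of_nonneg_left
      (measureReal_mono (Set.Ioi_subset_Ioi h2)) (Nat.cast_nonneg n)) h1

/-- A Potter type bound for the tail function along a norming sequence. -/
lemma tail_le_exp [IsProbabilityMeasure ρ] {α : ℕ → ℝ} {Q B : ℝ} {n₀ : ℕ} (hα : ∀ n, 0 < α n)
    (hQ : 1 < Q) (hdouble : ∀ n ≥ n₀, α (2 * n) ≤ Q * α n)
    (hbdd : ∀ n ≥ n₀, (n : ℝ) * ρ.real (Set.Ioi (α n)) ≤ B) {n : ℕ} (hn : n₀ ≤ n) {t : ℝ}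
    (ht : 0 ≤ t) :
    (n : ℝ) * ρ.real (Set.Ioi (α n * Real.exp t)) ≤
      2 * B * Real.exp (-(Real.log 2 / Real.log Q) * t) := by
  have hlQ : 0 < Real.log Q := Real.log_pos hQ
  have hQ0 : 0 < Q := by linarith
  have hpow : ∀ j : ℕ, α (2 ^ j * n) ≤ Q ^ j * α n := by
    intro j
    induction j with
    | zero => simp
    | succ j ih =>
      have h1 : n₀ ≤ 2 ^ j * n := hn.trans (Nat.le_mul_of_pos_left _ (by positivity))
      calc α (2 ^ (j + 1) * n) = α (2 * (2 ^ j * n)) := by ring_nf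
        _ ≤ Q * α (2 ^ j * n) := hdouble _ h1
        _ ≤ Q * (Q ^ j * α n) := by gcongr
        _ = _ := by ring
  -- The largest `j` with `Q ^ j ≤ exp t`: then `α (2 ^ j * n) ≤ α n * exp t`, and the tail there is
  -- at most `B / (2 ^ j * n)`.
  set j := ⌊t / Real.log Q⌋₊ with hj
  have hj1 : (j : ℝ) ≤ t / Real.log Q := Nat.floor_le (by positivity)
  have hj2 : t / Real.log Q < j + 1 := Nat.lt_floor_add_one _
  have hQj : Q ^ j ≤ Real.exp t := by
    rw [← Real.exp_log (pow_pos hQ0 j), Real.log_pow]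
    refine Real.exp_le_exp.2 ?_
    rwa [le_div_iff₀ hlQ] at hj1
  -- The leading factor 2 pays for rounding down in `j`.
  have h2j : ((2 : ℝ) ^ j)⁻¹ ≤ 2 * Real.exp (-(Real.log 2 / Real.log Q) * t) := by
    have h1 : Real.exp (Real.log 2 / Real.log Q * t) ≤ 2 ^ (j + 1) := by
      rw [← Real.exp_log (pow_pos two_pos (j + 1) : (0 : ℝ) < 2 ^ (j + 1)), Real.log_pow]
      refine Real.exp_le_exp.2 ?_
      calc Real.log 2 / Real.log Q * t = t / Real.log Q * Real.log 2 := by ring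
        _ ≤ (j + 1) * Real.log 2 := by gcongr
        _ = _ := by push_cast; ring
    rw [neg_mul, Real.exp_neg]
    have h2 := Real.exp_pos (Real.log 2 / Real.log Q * t)
    rw [inv_le_iff_one_le_mul₀ (by positivity)]
    have h3 : (1 : ℝ) = Real.exp (Real.log 2 / Real.log Q * t) *
      (Real.exp (Real.log 2 / Real.log Q * t))⁻¹ := by field_simp
    calc (1 : ℝ) = Real.exp (Real.log 2 / Real.log Q * t) *
      (Real.exp (Real.log 2 / Real.log Q * t))⁻¹ := h3
      _ ≤ 2 ^ (j + 1) * (Real.exp (Real.log 2 / Real.log Q * t))⁻¹ := by gcongr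
      _ = _ := by ring
  have h1 : n₀ ≤ 2 ^ j * n := hn.trans (Nat.le_mul_of_pos_left _ (by positivity))
  have h2 := hbdd _ h1
  push_cast at h2
  have h3 : ρ.real (Set.Ioi (α n * Real.exp t)) ≤ ρ.real (Set.Ioi (α (2 ^ j * n))) := by
    refine measureReal_mono (Set.Ioi_subset_Ioi ((hpow j).trans ?_))
    rw [mul_comm]
    gcongr
    exact (hα n).le
  calc (n : ℝ) * ρ.real (Set.Ioi (α n * Real.exp t))
      ≤ n * ρ.real (Set.Ioi (α (2 ^ j * n))) := by gcongr
    _ = ((2 : ℝ) ^ j)⁻¹ * (2 ^ j * n * ρ.real (Set.Ioi (α (2 ^ j * n)))) := by field_simp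
    _ ≤ 2 * Real.exp (-(Real.log 2 / Real.log Q) * t) * B := by gcongr
    _ = _ := by ring

end RegularVariation

/-! ### Moments of log⁺ excesses by the layer cake formula -/

section Moments

variable {ρ : Measure ℝ} {γ : ℝ}

lemma measurable_posLog_div (v : ℝ) : Measurable fun y : ℝ => Real.posLog (y / v) := by
  unfold Real.posLog
  fun_prop

lemma lt_posLog_div_iff {v y t : ℝ} (hv : 0 < v) (hy : 0 ≤ y) (ht : 0 ≤ t) :
    t < Real.posLog (y / v) ↔ v * Real.exp t < y := by
  rw [Real.posLog_eq_log_max_one (by positivity), Real.lt_log_iff_exp_lt (by positivity),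
    lt_max_iff, or_iff_right (not_lt.2 (Real.one_le_exp ht)), lt_div_iff₀ hv, mul_comm]

lemma measure_lt_posLog_div (hρ : ∀ᵐ r ∂ρ, 0 ≤ r) {v t : ℝ} (hv : 0 < v) (ht : 0 ≤ t) :
    ρ {y | t < Real.posLog (y / v)} = ρ (Set.Ioi (v * Real.exp t)) := by
  refine measure_congr ?_
  filter_upwards [hρ] with y hy
  exact propext (lt_posLog_div_iff hv hy ht)

/-- Half of the decay rate absorbs the weight `2 * t` from the layer cake formula for a square. -/
lemma mul_exp_neg_le {κ t : ℝ} (hκ : 0 < κ) :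
    2 * t * Real.exp (-κ * t) ≤ 4 / κ * Real.exp (-(κ / 2) * t) := by
  have h1 : t ≤ 2 / κ * Real.exp (κ / 2 * t) := by
    have h2 : κ / 2 * t ≤ Real.exp (κ / 2 * t) := by linarith [Real.add_one_le_exp (κ / 2 * t)]
    calc t = 2 / κ * (κ / 2 * t) := by field_simp
      _ ≤ _ := by gcongr
  calc 2 * t * Real.exp (-κ * t)
      ≤ 2 * (2 / κ * Real.exp (κ / 2 * t)) * Real.exp (-κ * t) := by gcongr
    _ = 4 / κ * (Real.exp (κ / 2 * t) * Real.exp (-κ * t)) := by ring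
    _ = _ := by rw [← Real.exp_add]; congr 2; ring

lemma lintegral_posLog_sq_le [IsProbabilityMeasure ρ] (hρ : ∀ᵐ r ∂ρ, 0 ≤ r) {v C κ : ℝ} (hv : 0 < v)
    (hC : 0 ≤ C) (hκ : 0 < κ)
    (htail : ∀ t : ℝ, 0 ≤ t → ρ.real (Set.Ioi (v * Real.exp t)) ≤ C * Real.exp (-κ * t)) :
    ∫⁻ y, ENNReal.ofReal (Real.posLog (y / v) ^ 2) ∂ρ ≤ ENNReal.ofReal (8 * C / κ ^ 2) := by
  have hlayer := lintegral_comp_eq_lintegral_meas_lt_mul (f := fun y => Real.posLog (y / v))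
    (g := fun t => 2 * t) ρ (Eventually.of_forall fun y => Real.posLog_nonneg)
    (measurable_posLog_div v).aemeasurable
    (fun t _ => (continuous_const.mul continuous_id).intervalIntegrable _ _)
    ((ae_restrict_mem measurableSet_Ioi).mono fun t (ht : 0 < t) => by positivity)
  have hsq : ∀ y : ℝ, ∫ t in (0 : ℝ)..Real.posLog (y / v), 2 * t = Real.posLog (y / v) ^ 2 := by
    intro y
    rw [intervalIntegral.integral_const_mul, integral_id]
    ring
  simp_rw [hsq] at hlayer
  rw [hlayer]
  have hκ2 : -(κ / 2) < 0 := by linarith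
  have hint : IntegrableOn (fun t => C * (4 / κ * Real.exp (-(κ / 2) * t))) (Set.Ioi 0) :=
    ((integrableOn_exp_mul_Ioi hκ2 0).const_mul _).const_mul _
  calc _ ≤ ∫⁻ t in Set.Ioi 0, ENNReal.ofReal (C * (4 / κ * Real.exp (-(κ / 2) * t))) := by
        refine setLIntegral_mono' measurableSet_Ioi fun t (ht : 0 < t) => ?_
        rw [measure_lt_posLog_div hρ hv ht.le, ← ofReal_measureReal,
          ← ENNReal.ofReal_mul measureReal_nonneg]
        refine ENNReal.ofReal_le_ofReal ?_
        calc _ ≤ C * Real.exp (-κ * t) * (2 * t) := by gcongr; exact htail t ht.le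
          _ = C * (2 * t * Real.exp (-κ * t)) := by ring
          _ ≤ _ := mul_le_mul_of_nonneg_left (mul_exp_neg_le hκ) hC
    _ = ENNReal.ofReal (∫ t in Set.Ioi 0, C * (4 / κ * Real.exp (-(κ / 2) * t))) :=
        (ofReal_integral_eq_lintegral_ofReal hint (Eventually.of_forall fun t => by positivity)).symm
    _ = _ := by
        rw [integral_const_mul, integral_const_mul, integral_exp_mul_Ioi hκ2]
        congr 1
        rw [mul_zero, Real.exp_zero]
        field_simp
        ring

lemma memLp_posLog_div [IsProbabilityMeasure ρ] (hρ : ∀ᵐ r ∂ρ, 0 ≤ r) {v C κ : ℝ} (hv : 0 < v)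
    (hC : 0 ≤ C) (hκ : 0 < κ)
    (htail : ∀ t : ℝ, 0 ≤ t → ρ.real (Set.Ioi (v * Real.exp t)) ≤ C * Real.exp (-κ * t)) :
    MemLp (fun y => Real.posLog (y / v)) 2 ρ := by
  rw [memLp_two_iff_integrable_sq (measurable_posLog_div v).aestronglyMeasurable]
  refine ⟨((measurable_posLog_div v).pow_const 2).aestronglyMeasurable, ?_⟩
  rw [hasFiniteIntegral_iff_ofReal (Eventually.of_forall fun y => sq_nonneg _)]
  exact (lintegral_posLog_sq_le hρ hv hC hκ htail).trans_lt ENNReal.ofReal_lt_top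

lemma integral_posLog_sq_le [IsProbabilityMeasure ρ] (hρ : ∀ᵐ r ∂ρ, 0 ≤ r) {v C κ : ℝ} (hv : 0 < v)
    (hC : 0 ≤ C) (hκ : 0 < κ)
    (htail : ∀ t : ℝ, 0 ≤ t → ρ.real (Set.Ioi (v * Real.exp t)) ≤ C * Real.exp (-κ * t)) :
    ∫ y, Real.posLog (y / v) ^ 2 ∂ρ ≤ 8 * C / κ ^ 2 := by
  rw [integral_eq_lintegral_of_nonneg_ae (Eventually.of_forall fun y => sq_nonneg _)
    ((measurable_posLog_div v).pow_const 2).aestronglyMeasurable]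
  exact ENNReal.toReal_le_of_le_ofReal (by positivity) (lintegral_posLog_sq_le hρ hv hC hκ htail)

lemma integral_posLog_div_eq [IsProbabilityMeasure ρ] (hρ : ∀ᵐ r ∂ρ, 0 ≤ r) {v : ℝ} (hv : 0 < v)
    (hint : Integrable (fun y => Real.posLog (y / v)) ρ) :
    ∫ y, Real.posLog (y / v) ∂ρ = ∫ t in Set.Ioi 0, ρ.real (Set.Ioi (v * Real.exp t)) := by
  rw [hint.integral_eq_integral_meas_lt (Eventually.of_forall fun y => Real.posLog_nonneg)]
  refine setIntegral_congr_fun measurableSet_Ioi fun t (ht : 0 < t) => ?_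
  rw [measureReal_def, measure_lt_posLog_div hρ hv ht.le, measureReal_def]

lemma integral_rpow_exp (hγ : 0 < γ) {c : ℝ} (hc : 0 < c) :
    ∫ t in Set.Ioi (0 : ℝ), (c * Real.exp t) ^ (-1 / γ) = γ * c ^ (-1 / γ) := by
  have hexp : -1 / γ < 0 := div_neg_of_neg_of_pos (by norm_num) hγ
  have h : ∀ t : ℝ, (c * Real.exp t) ^ (-1 / γ) = c ^ (-1 / γ) * Real.exp (-1 / γ * t) := by
    intro t
    rw [Real.mul_rpow hc.le (Real.exp_pos t).le, ← Real.exp_mul, mul_comm t]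
  simp_rw [h]
  rw [integral_const_mul, integral_exp_mul_Ioi hexp, mul_zero, Real.exp_zero]
  field_simp

/-- Moments of the positive part of the logarithmic excess over high thresholds. -/
lemma posLog_moments [IsProbabilityMeasure ρ] (hρ : ∀ᵐ r ∂ρ, 0 ≤ r) (hγ : 0 < γ) {α : ℕ → ℝ}
    (hα : ∀ n, 0 < α n) (hratio : Tendsto (fun n => α n / α (n / 2)) atTop (𝓝 (2 ^ γ)))
    (htail : ∀ y : ℝ, 0 < y →
      Tendsto (fun n : ℕ => (n : ℝ) * ρ.real (Set.Ioi (α n * y))) atTop (𝓝 (y ^ (-1 / γ))))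
    {c : ℝ} (hc : 0 < c) :
    (∀ᶠ n in atTop, MemLp (fun y => Real.posLog (y / (α n * c))) 2 ρ) ∧
    (∃ K, ∀ᶠ n : ℕ in atTop, (n : ℝ) * ∫ y, Real.posLog (y / (α n * c)) ^ 2 ∂ρ ≤ K) ∧
    Tendsto (fun n : ℕ => (n : ℝ) * ∫ y, Real.posLog (y / (α n * c)) ∂ρ) atTop
      (𝓝 (γ * c ^ (-1 / γ))) := by
  -- Any `Q` above the limit ratio and `B` above the limit tail at `c` would do for the Potter
  -- bound.
  set Q : ℝ := 2 ^ γ + 1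
  have hQ : 1 < Q := by
    have : (0 : ℝ) < 2 ^ γ := by positivity
    linarith
  set B : ℝ := c ^ (-1 / γ) + 1
  have hB : 0 < B := by positivity
  set κ : ℝ := Real.log 2 / Real.log Q
  have hκ : 0 < κ := div_pos (Real.log_pos one_lt_two) (Real.log_pos hQ)
  obtain ⟨n₀, hn₀⟩ := eventually_atTop.1
    ((hratio.eventually (gt_mem_nhds (lt_add_one _))).and
      ((htail c hc).eventually (gt_mem_nhds (lt_add_one _))))
  have hpotter : ∀ n ≥ n₀, ∀ t : ℝ, 0 ≤ t →
      (n : ℝ) * ρ.real (Set.Ioi (α n * c * Real.exp t)) ≤ 2 * B * Real.exp (-κ * t) := by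
    intro n hn t ht
    refine tail_le_exp (α := fun n => α n * c) (n₀ := n₀) (fun n => mul_pos (hα n) hc) hQ
      (fun n hn => ?_) (fun n hn => (hn₀ n hn).2.le) hn ht
    have h1 := (hn₀ (2 * n) (by omega)).1
    rw [Nat.mul_div_cancel_left _ two_pos, div_lt_iff₀ (hα n)] at h1
    nlinarith
  have hdecay : ∀ n ≥ n₀ + 1, ∀ t : ℝ, 0 ≤ t →
      ρ.real (Set.Ioi (α n * c * Real.exp t)) ≤ 2 * B / n * Real.exp (-κ * t) := by
    intro n hn t ht
    have hn0 : 0 < (n : ℝ) := by exact_mod_cast (by omega : 0 < n)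
    have := hpotter n (by omega) t ht
    rw [div_mul_eq_mul_div, le_div_iff₀ hn0]
    linarith
  have hmem : ∀ n ≥ n₀ + 1, MemLp (fun y => Real.posLog (y / (α n * c))) 2 ρ := fun n hn =>
    memLp_posLog_div hρ (mul_pos (hα n) hc) (by positivity) hκ (hdecay n hn)
  refine ⟨eventually_atTop.2 ⟨_, hmem⟩, ⟨16 * B / κ ^ 2, ?_⟩, ?_⟩
  · filter_upwards [eventually_ge_atTop (n₀ + 1)] with n hn
    have hn0 : 0 < (n : ℝ) := by exact_mod_cast (by omega : 0 < n)
    calc _ ≤ (n : ℝ) * (8 * (2 * B / n) / κ ^ 2) := by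
          gcongr
          exact integral_posLog_sq_le hρ (mul_pos (hα n) hc) (by positivity) hκ (hdecay n hn)
      _ = _ := by field_simp; norm_num
  · rw [← integral_rpow_exp hγ hc]
    have hlim : Tendsto (fun n : ℕ => ∫ t in Set.Ioi (0 : ℝ),
        (n : ℝ) * ρ.real (Set.Ioi (α n * c * Real.exp t))) atTop
        (𝓝 (∫ t in Set.Ioi (0 : ℝ), (c * Real.exp t) ^ (-1 / γ))) := by
      -- The Potter bound is an integrable majorant independent of `n`.
      refine tendsto_integral_filter_of_dominated_convergence
        (fun t => 2 * B * Real.exp (-κ * t)) ?_ ?_ ?_ ?_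
      · refine Eventually.of_forall fun n => Measurable.aestronglyMeasurable ?_
        refine (Antitone.measurable fun s t hst => ?_).const_mul _
        refine measureReal_mono (Set.Ioi_subset_Ioi ?_)
        have := mul_pos (hα n) hc
        gcongr
      · filter_upwards [eventually_ge_atTop n₀] with n hn
        filter_upwards [ae_restrict_mem measurableSet_Ioi] with t ht
        rw [Real.norm_of_nonneg (by positivity)]
        exact hpotter n hn t (le_of_lt ht)
      · exact (integrableOn_exp_mul_Ioi (by linarith) 0).const_mul _
      · refine Eventually.of_forall fun t => ?_
        simpa only [mul_assoc] using htail (c * Real.exp t) (by positivity)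
    refine hlim.congr' ?_
    filter_upwards [eventually_ge_atTop (n₀ + 1)] with n hn
    rw [integral_const_mul, integral_posLog_div_eq hρ (mul_pos (hα n) hc)
      ((hmem n hn).integrable (by norm_num))]

end Moments

/-! ### A weak law for triangular arrays, and passage to the index `⌊n / k⌋` -/

section LawOfLargeNumbers

variable {Ω : Type*} [MeasurableSpace Ω] {P : Measure Ω} [IsProbabilityMeasure P] {ρ : Measure ℝ}
  {γ : ℝ}

/-- A weak law of large numbers for row sums `∑ i < n, f n (Y i)` normalized by `k n`. -/
lemma tendsto_measure_sum_sub_ge {Y : ℕ → Ω → ℝ} (hY : ∀ i, Measurable (Y i))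
    (hlaw : ∀ i, P.map (Y i) = ρ) (hind : iIndepFun Y P) {f : ℕ → ℝ → ℝ}
    (hf : ∀ n, Measurable (f n)) {k : ℕ → ℕ} {l : ℝ} (hLp : ∀ᶠ n in atTop, MemLp (f n) 2 ρ)
    (hmean : Tendsto (fun n : ℕ => (n : ℝ) / k n * ∫ y, f n y ∂ρ) atTop (𝓝 l))
    (hvar : Tendsto (fun n : ℕ => (n : ℝ) / k n * (∫ y, f n y ^ 2 ∂ρ) / k n) atTop (𝓝 0))
    {ε : ℝ} (hε : 0 < ε) :
    Tendsto (fun n : ℕ => P {ω | ε ≤ |1 / (k n : ℝ) * ∑ i : Fin n, f n (Y i ω) - l|})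
      atTop (𝓝 0) := by
  -- Half of `ε` is reserved for the bias of the mean; Chebyshev handles the rest, the variance
  -- being at most `n / k n ^ 2` times the second moment of `f n`.
  have hlim : Tendsto (fun n : ℕ =>
      ENNReal.ofReal ((n : ℝ) / k n * (∫ y, f n y ^ 2 ∂ρ) / k n / (ε / 2) ^ 2)) atTop (𝓝 0) := by
    have := ENNReal.tendsto_ofReal (hvar.div_const ((ε / 2) ^ 2))
    simpa using this
  refine tendsto_of_tendsto_of_tendsto_of_le_of_le' tendsto_const_nhds hlim
    (Eventually.of_forall fun n => zero_le) ?_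
  have hmean' : ∀ᶠ n : ℕ in atTop, |(n : ℝ) / k n * ∫ y, f n y ∂ρ - l| < ε / 2 := by
    have := Metric.tendsto_nhds.1 hmean (ε / 2) (half_pos hε)
    simpa only [Real.dist_eq] using this
  filter_upwards [hLp, hmean'] with n hn hm
  set Z : Fin n → Ω → ℝ := fun i ω => f n (Y i ω) with hZ
  have hZLp : ∀ i, MemLp (Z i) 2 P := fun i => by
    have := hn
    rw [← hlaw i] at this
    exact this.comp_of_map (hY i).aemeasurable
  have hZint : ∀ i, ∫ ω, Z i ω ∂P = ∫ y, f n y ∂ρ := fun i => by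
    rw [← hlaw i, integral_map (hY i).aemeasurable (hf n).aestronglyMeasurable]
  have hZsq : ∀ i, ∫ ω, Z i ω ^ 2 ∂P = ∫ y, f n y ^ 2 ∂ρ := fun i => by
    rw [← hlaw i, integral_map (hY i).aemeasurable ((hf n).pow_const 2).aestronglyMeasurable]
  have hZind : Set.Pairwise ((Finset.univ : Finset (Fin n)) : Set (Fin n))
      fun i j => IndepFun (Z i) (Z j) P := fun i _ j _ hij =>
    (hind.indepFun (fun h => hij (Fin.ext h))).comp (hf n) (hf n)
  set T : Ω → ℝ := fun ω => 1 / (k n : ℝ) * (∑ i, Z i) ω with hT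
  have hsumLp : MemLp (∑ i, Z i) 2 P := memLp_finsetSum' _ fun i _ => hZLp i
  have hTLp : MemLp T 2 P := hsumLp.const_mul _
  have hTmean : ∫ ω, T ω ∂P = (n : ℝ) / k n * ∫ y, f n y ∂ρ := by
    simp only [hT, Finset.sum_apply]
    rw [integral_const_mul, integral_finsetSum _ fun i _ => (hZLp i).integrable (by norm_num)]
    simp only [hZint, Finset.sum_const, Finset.card_univ, Fintype.card_fin, nsmul_eq_mul]
    ring
  have hTvar : variance T P ≤ (n : ℝ) / k n * (∫ y, f n y ^ 2 ∂ρ) / k n := by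
    have h1 : variance T P = (1 / (k n : ℝ)) ^ 2 * ∑ i, variance (Z i) P := by
      rw [hT, variance_const_mul, IndepFun.variance_sum (fun i _ => hZLp i) hZind]
    have h2 : ∑ i, variance (Z i) P ≤ n * ∫ y, f n y ^ 2 ∂ρ := by
      calc _ ≤ ∑ _i : Fin n, ∫ y, f n y ^ 2 ∂ρ := by
            refine Finset.sum_le_sum fun i _ => ?_
            rw [← hZsq i]
            exact variance_le_expectation_sq (hZLp i).1
        _ = _ := by simp
    rw [h1]
    calc _ ≤ (1 / (k n : ℝ)) ^ 2 * (n * ∫ y, f n y ^ 2 ∂ρ) := by gcongr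
      _ = _ := by ring
  have hcheb := meas_ge_le_variance_div_sq hTLp (half_pos hε)
  calc P {ω | ε ≤ |1 / (k n : ℝ) * ∑ i : Fin n, f n (Y i ω) - l|}
      ≤ P {ω | ε / 2 ≤ |T ω - ∫ ω, T ω ∂P|} := by
        refine measure_mono fun ω hω => ?_
        have h1 : T ω = 1 / (k n : ℝ) * ∑ i : Fin n, f n (Y i ω) := by
          simp only [hT, hZ, Finset.sum_apply]
        simp only [Set.mem_ofPred_eq] at hω ⊢
        rw [← h1] at hω
        rw [hTmean]
        have h2 := abs_sub_le (T ω) ((n : ℝ) / k n * ∫ y, f n y ∂ρ) l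
        linarith
    _ ≤ ENNReal.ofReal (variance T P / (ε / 2) ^ 2) := hcheb
    _ ≤ _ := ENNReal.ofReal_le_ofReal (by gcongr)

lemma tendsto_div_atTop_of_intermediate {k : ℕ → ℕ} (hk : Tendsto k atTop atTop)
    (hkn : Tendsto (fun n : ℕ => (k n : ℝ) / (n : ℝ)) atTop (𝓝 0)) :
    Tendsto (fun n : ℕ => (n : ℝ) / (k n : ℝ)) atTop atTop := by
  have h1 : Tendsto (fun n : ℕ => (k n : ℝ) / (n : ℝ)) atTop (𝓝[>] 0) := by
    refine tendsto_nhdsWithin_iff.2 ⟨hkn, ?_⟩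
    filter_upwards [hk.eventually (eventually_gt_atTop 0), eventually_gt_atTop 0] with n h2 h3
    have h4 : (0 : ℝ) < k n := Nat.cast_pos.2 h2
    have h5 : (0 : ℝ) < n := Nat.cast_pos.2 h3
    exact Set.mem_Ioi.2 (div_pos h4 h5)
  refine h1.inv_tendsto_nhdsGT_zero.congr fun n => ?_
  simp

lemma tendsto_natDiv_atTop_of_intermediate {k : ℕ → ℕ} (hk : Tendsto k atTop atTop)
    (hkn : Tendsto (fun n : ℕ => (k n : ℝ) / (n : ℝ)) atTop (𝓝 0)) :
    Tendsto (fun n : ℕ => n / k n) atTop atTop := by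
  refine (tendsto_nat_floor_atTop.comp (tendsto_div_atTop_of_intermediate hk hkn)).congr fun n => ?_
  exact Nat.floor_div_eq_div n (k n)

lemma tendsto_div_div_natDiv {k : ℕ → ℕ} (hk : Tendsto k atTop atTop)
    (hkn : Tendsto (fun n : ℕ => (k n : ℝ) / (n : ℝ)) atTop (𝓝 0)) :
    Tendsto (fun n : ℕ => (n : ℝ) / k n / ((n / k n : ℕ) : ℝ)) atTop (𝓝 1) := by
  have h1 := ((tendsto_nat_floor_div_atTop (R := ℝ)).comp
    (tendsto_div_atTop_of_intermediate hk hkn)).inv₀ one_ne_zero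
  rw [inv_one] at h1
  refine h1.congr fun n => ?_
  simp only [Function.comp]
  rw [Nat.floor_div_eq_div, inv_div]

/-- `n / k n` in `ℕ` is the floor of the real quotient, and their ratio tends to 1 because the
quotient diverges. -/
lemma tendsto_div_mul_of_tendsto_mul {k : ℕ → ℕ} (hk : Tendsto k atTop atTop)
    (hkn : Tendsto (fun n : ℕ => (k n : ℝ) / (n : ℝ)) atTop (𝓝 0)) {g : ℕ → ℝ} {l : ℝ}
    (hg : Tendsto (fun n : ℕ => (n : ℝ) * g n) atTop (𝓝 l)) :
    Tendsto (fun n : ℕ => (n : ℝ) / k n * g (n / k n)) atTop (𝓝 l) := by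
  have hN := tendsto_natDiv_atTop_of_intermediate hk hkn
  have h1 := (tendsto_div_div_natDiv hk hkn).mul (hg.comp hN)
  rw [one_mul] at h1
  refine h1.congr' ?_
  filter_upwards [hN.eventually (eventually_gt_atTop 0)] with n hn
  have : ((n / k n : ℕ) : ℝ) ≠ 0 := by positivity
  simp only [Function.comp]
  field_simp

/-- The extra factor `1 / k n` makes the variances vanish when the rescaled second moments are
merely bounded. -/
lemma tendsto_div_mul_div_zero {k : ℕ → ℕ} (hk : Tendsto k atTop atTop)
    (hkn : Tendsto (fun n : ℕ => (k n : ℝ) / (n : ℝ)) atTop (𝓝 0)) {g : ℕ → ℝ} {K : ℝ}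
    (hg0 : ∀ n, 0 ≤ g n) (hg : ∀ᶠ n : ℕ in atTop, (n : ℝ) * g n ≤ K) :
    Tendsto (fun n : ℕ => (n : ℝ) / k n * g (n / k n) / k n) atTop (𝓝 0) := by
  have hN := tendsto_natDiv_atTop_of_intermediate hk hkn
  have hkinv : Tendsto (fun n => ((k n : ℝ))⁻¹) atTop (𝓝 0) :=
    (tendsto_inv_atTop_nhds_zero_nat (𝕜 := ℝ)).comp hk
  have h1 : Tendsto (fun n : ℕ => (n : ℝ) / k n / ((n / k n : ℕ) : ℝ) * K * ((k n : ℝ))⁻¹)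
      atTop (𝓝 0) := by
    simpa using ((tendsto_div_div_natDiv hk hkn).mul_const K).mul hkinv
  refine tendsto_of_tendsto_of_tendsto_of_le_of_le' tendsto_const_nhds h1
    (Eventually.of_forall fun n => ?_) ?_
  · have := hg0 (n / k n)
    positivity
  · filter_upwards [hN.eventually (eventually_gt_atTop 0), hN.eventually hg] with n hn hgn
    have h2 : ((n / k n : ℕ) : ℝ) ≠ 0 := by positivity
    calc (n : ℝ) / k n * g (n / k n) / k n
        = (n : ℝ) / k n / ((n / k n : ℕ) : ℝ) * (((n / k n : ℕ) : ℝ) * g (n / k n)) *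
          ((k n : ℝ))⁻¹ := by field_simp
      _ ≤ _ := by gcongr

end LawOfLargeNumbers

/-! ### Deterministic thresholds and consistency -/

section Consistency

variable {Ω : Type*} [MeasurableSpace Ω] {P : Measure Ω} [IsProbabilityMeasure P] {ρ : Measure ℝ}
  {γ : ℝ}

lemma sum_indicator_Ioi {n : ℕ} (y : Fin n → ℝ) (v : ℝ) :
    ∑ i, (Set.Ioi v).indicator (fun _ => (1 : ℝ)) (y i) =
      ((Finset.univ.filter fun i => v < y i).card : ℝ) := by
  simp [Set.indicator_apply, Finset.sum_boole]

/-- Along an intermediate sequence there are thresholds `u n → ∞` for which the empirical tail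
function and the empirical mean logarithmic excess converge in probability. -/
lemma exists_thresholds [IsProbabilityMeasure ρ] (hρ : ∀ᵐ r ∂ρ, 0 ≤ r) (hγ : 0 < γ)
    (hevi : HasExtremeValueIndex ρ γ) {Y : ℕ → Ω → ℝ} (hY : ∀ i, Measurable (Y i))
    (hlaw : ∀ i, P.map (Y i) = ρ) (hind : iIndepFun Y P) {k : ℕ → ℕ} (hk : Tendsto k atTop atTop)
    (hkn : Tendsto (fun n : ℕ => (k n : ℝ) / (n : ℝ)) atTop (𝓝 0)) :
    ∃ u : ℕ → ℝ, Tendsto u atTop atTop ∧ ∀ c : ℝ, 0 < c → ∀ ε : ℝ, 0 < ε →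
      Tendsto (fun n : ℕ => P {ω | ε ≤ |1 / (k n : ℝ) *
        ((Finset.univ.filter fun i : Fin n => u n * c < Y i ω).card : ℝ) - c ^ (-1 / γ)|})
        atTop (𝓝 0) ∧
      Tendsto (fun n : ℕ => P {ω | ε ≤ |1 / (k n : ℝ) *
        ∑ i : Fin n, Real.posLog (Y i ω / (u n * c)) - γ * c ^ (-1 / γ)|}) atTop (𝓝 0) := by
  obtain ⟨α, hα, hαtop, hratio, htail⟩ := exists_tendsto_tail hγ hevi
  have hN := tendsto_natDiv_atTop_of_intermediate hk hkn
  -- With `u n = α ⌊n / k n⌋` the expected number of exceedances of `u n` among `n` observations is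
  -- asymptotically `k n`.
  refine ⟨fun n => α (n / k n), hαtop.comp hN, fun c hc ε hε => ⟨?_, ?_⟩⟩
  · have hint : ∀ v : ℝ, ∫ y, (Set.Ioi v).indicator (fun _ => (1 : ℝ)) y ∂ρ = ρ.real (Set.Ioi v) :=
      fun v => integral_indicator_one measurableSet_Ioi
    have hsq : ∀ v y : ℝ, (Set.Ioi v).indicator (fun _ => (1 : ℝ)) y ^ 2 =
        (Set.Ioi v).indicator (fun _ => (1 : ℝ)) y := fun v y => by
      by_cases h : y ∈ Set.Ioi v <;> simp [h]
    simp_rw [← sum_indicator_Ioi]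
    refine tendsto_measure_sum_sub_ge hY hlaw hind
      (f := fun n => (Set.Ioi (α (n / k n) * c)).indicator fun _ => (1 : ℝ))
      (fun n => measurable_const.indicator measurableSet_Ioi)
      (Eventually.of_forall fun n => (memLp_const 1).indicator measurableSet_Ioi) ?_ ?_ hε
    · simp_rw [hint]
      exact tendsto_div_mul_of_tendsto_mul hk hkn (htail c hc)
    · simp_rw [hsq, hint]
      exact tendsto_div_mul_div_zero hk hkn (g := fun n => ρ.real (Set.Ioi (α n * c)))
        (fun n => measureReal_nonneg)
        (((htail c hc).eventually (gt_mem_nhds (lt_add_one _))).mono fun n hn => hn.le)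
  · obtain ⟨hLp, ⟨K, hK⟩, hmean⟩ := posLog_moments hρ hγ hα hratio htail hc
    refine tendsto_measure_sum_sub_ge hY hlaw hind
      (f := fun n y => Real.posLog (y / (α (n / k n) * c)))
      (fun n => measurable_posLog_div _) (hN.eventually hLp) ?_ ?_ hε
    · exact tendsto_div_mul_of_tendsto_mul hk hkn
        (g := fun n => ∫ y, Real.posLog (y / (α n * c)) ∂ρ) hmean
    · exact tendsto_div_mul_div_zero hk hkn
        (g := fun n => ∫ y, Real.posLog (y / (α n * c)) ^ 2 ∂ρ)
        (fun n => integral_nonneg fun y => sq_nonneg _) hK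

/-- Fixes a distortion `c` for which the loss `c ^ 3` in `hill_bounds` costs less than `ε`; both
expressions are continuous in `c` with value `γ` at 1. -/
lemma exists_one_lt_rpow_close (γ : ℝ) {ε : ℝ} (hε : 0 < ε) :
    ∃ c : ℝ, 1 < c ∧ γ - ε < γ * (c ^ 3) ^ (-1 / γ) ∧ γ * ((c ^ 3)⁻¹) ^ (-1 / γ) < γ + ε := by
  have h1 : ContinuousAt (fun c : ℝ => γ * (c ^ 3) ^ (-1 / γ)) 1 :=
    continuousAt_const.mul ((continuousAt_id.pow 3).rpow_const (Or.inl (by simp)))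
  have h2 : ContinuousAt (fun c : ℝ => γ * ((c ^ 3)⁻¹) ^ (-1 / γ)) 1 :=
    continuousAt_const.mul
      (((continuousAt_id.pow 3).inv₀ (by simp)).rpow_const (Or.inl (by simp)))
  have h3 := h1.eventually (lt_mem_nhds (show γ - ε < γ * ((1 : ℝ) ^ 3) ^ (-1 / γ) by simpa))
  have h4 := h2.eventually
    (gt_mem_nhds (show γ * (((1 : ℝ) ^ 3)⁻¹) ^ (-1 / γ) < γ + ε by simpa))
  obtain ⟨c, hc, hc1⟩ := (((h3.and h4).filter_mono (nhdsWithin_le_nhds (s := Set.Ioi 1))).and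
    self_mem_nhdsWithin).exists
  exact ⟨c, hc1, hc⟩

end Consistency

theorem theorem4 {Ω : Type*} [MeasurableSpace Ω] (P : Measure Ω) [IsProbabilityMeasure P]
    (d : ℕ) (hd : 2 ≤ d)
    -- the elliptical distribution, with its parameters and extreme value index
    (ν : Measure (EuclideanSpace ℝ (Fin d))) (m : EuclideanSpace ℝ (Fin d))
    (S : Matrix (Fin d) (Fin d) ℝ) (ρ : Measure ℝ) (hν : IsElliptical ν m S ρ)
    (γ : ℝ) (hγ : 0 < γ) (hρ : HasExtremeValueIndex ρ γ)
    -- the i.i.d. sequence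
    (X : ℕ → Ω → EuclideanSpace ℝ (Fin d)) (hXm : ∀ i, Measurable (X i))
    (hXlaw : ∀ i, P.map (X i) = ν) (hXindep : iIndepFun X P)
    -- the consistent estimators of location and scatter
    (mhat : ℕ → Ω → EuclideanSpace ℝ (Fin d)) (hmhat : IsConsistent P mhat m)
    (Shat : ℕ → Ω → Matrix (Fin d) (Fin d) ℝ) (hShat : IsConsistent P Shat S)
    -- the number of observations that are used
    (k : ℕ → ℕ) (hk : Tendsto k atTop atTop)
    (hkn : Tendsto (fun n : ℕ => (k n : ℝ) / (n : ℝ)) atTop (𝓝 0)) :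
    TendstoInMeasure P
      (fun (n : ℕ) (ω : Ω) =>
        separatingHill (fun i : Fin n => X i ω) (mhat n ω) (Shat n ω) (k n))
      atTop (fun _ => γ) := by
  have hd0 : d ≠ 0 := by omega
  have := hν.isProbabilityMeasure
  obtain ⟨L, hL, -⟩ := hν.exists_eq
  set Y : ℕ → Ω → ℝ := fun i ω => mahalanobis S (X i ω) m with hYdef
  have hmaha : Measurable fun x => mahalanobis S x m := (continuous_mahalanobis_left S m).measurable
  have hY : ∀ i, Measurable (Y i) := fun i => hmaha.comp (hXm i)
  have hlaw : ∀ i, P.map (Y i) = ρ := fun i => by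
    rw [← map_mahalanobis_of_isElliptical hd0 hν, ← hXlaw i, Measure.map_map hmaha (hXm i)]
    rfl
  have hind : iIndepFun Y P := hXindep.comp _ fun _ => hmaha
  obtain ⟨u, hu, hconv⟩ := exists_thresholds hν.nonneg hγ hρ hY hlaw hind hk hkn
  rw [IsConsistent, tendstoInMeasure_iff_norm] at hmhat hShat
  rw [tendstoInMeasure_iff_norm]
  intro ε hε
  obtain ⟨c, hc, hc1, hc2⟩ := exists_one_lt_rpow_close γ (half_pos hε)
  have hc0 : 0 < c := by linarith
  obtain ⟨δ, hδ, hclose⟩ := exists_mahalanobis_close hν.posDef hL m hc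
  have hexp : -1 / γ < 0 := div_neg_of_neg_of_pos (by norm_num) hγ
  -- The gaps between these limits and 1 are the tolerances that force more than `k n` exceedances
  -- of `u n / c` and at most `k n` of `c * u n`.
  have hlow : 1 < (c⁻¹ : ℝ) ^ (-1 / γ) :=
    Real.one_lt_rpow_of_pos_of_lt_one_of_neg (inv_pos.2 hc0) (inv_lt_one_of_one_lt₀ hc) hexp
  have hupp : c ^ (-1 / γ) < 1 := Real.rpow_lt_one_of_one_lt_of_neg hc hexp
  have hlim := ((((((hmhat δ hδ).add (hShat δ hδ)).add
    (hconv _ (inv_pos.2 hc0) _ (sub_pos.2 hlow)).1).add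
    (hconv _ hc0 _ (sub_pos.2 hupp)).1).add
    (hconv (c ^ 3) (by positivity) _ (half_pos hε)).2).add
    (hconv (c ^ 3)⁻¹ (by positivity) _ (half_pos hε)).2)
  simp only [add_zero] at hlim
  refine tendsto_of_tendsto_of_tendsto_of_le_of_le' tendsto_const_nhds hlim
    (Eventually.of_forall fun n => zero_le) ?_
  filter_upwards [hu.eventually (eventually_gt_atTop (c ^ 3)),
    hk.eventually (eventually_gt_atTop 0)] with n hun hkpos
  have hk0 : (0 : ℝ) < k n := by exact_mod_cast hkpos
  -- Union bound over six bad events: either estimator being off by at least `δ`, two exceedance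
  -- counts, and two log⁺ sums. Outside them the estimate is deterministic, and no measurability of
  -- the estimators is needed.
  refine le_trans (measure_mono ?_) ((measure_union_le _ _).trans (add_le_add_left
    ((measure_union_le _ _).trans (add_le_add_left
    ((measure_union_le _ _).trans (add_le_add_left
    ((measure_union_le _ _).trans (add_le_add_left (measure_union_le _ _) _)) _)) _)) _))
  intro ω hω
  by_contra hgood
  simp only [Set.mem_union, Set.mem_ofPred_eq, not_or, not_le] at hgood hω
  obtain ⟨⟨⟨⟨⟨h1, h2⟩, h3⟩, h4⟩, h5⟩, h6⟩ := hgood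
  have hcl := fun i : Fin n => hclose _ _ h2 h1 (X i ω)
  have hcard1 : k n < (Finset.univ.filter fun i : Fin n => u n / c < Y i ω).card := by
    have h7 := (abs_lt.1 h3).1
    rw [one_div_mul_eq_div, ← div_eq_mul_inv] at h7
    have h8 : 1 < ((Finset.univ.filter fun i : Fin n => u n / c < Y i ω).card : ℝ) / k n := by
      linarith
    rw [one_lt_div hk0] at h8
    exact_mod_cast h8
  have hcard2 : (Finset.univ.filter fun i : Fin n => c * u n < Y i ω).card ≤ k n := by
    have h7 := (abs_lt.1 h4).2
    rw [one_div_mul_eq_div, mul_comm (u n)] at h7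
    have h8 : ((Finset.univ.filter fun i : Fin n => c * u n < Y i ω).card : ℝ) / k n < 1 := by
      linarith
    rw [div_lt_one hk0] at h8
    exact_mod_cast h8.le
  obtain ⟨hb1, hb2⟩ := hill_bounds hc hun (fun i => mahalanobis_nonneg _ _ _)
    (fun i => mahalanobis_nonneg _ _ _) (fun i => (hcl i).1) (fun i => (hcl i).2) hcard1 hcard2
  have h7 := (abs_lt.1 h5).1
  have h8 := (abs_lt.1 h6).2
  rw [← div_eq_mul_inv] at h8
  rw [mul_comm (u n)] at h7
  refine absurd hω (not_le.2 (abs_lt.2 ⟨?_, ?_⟩)) <;> rw [separatingHill]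
  · linarith
  · linarith
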